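/- Consider the two-player miner's dilemma game with betrayal. Its parameters are real numbers $m, m_1, m_2, p$ with $m_1 > 0$, $m_2 > 0$, $m_1 + m_2 \le m$ and $0 \le p < 1$, where $m$ is the total mining power of the system, $m_i$ is the mining power of pool $i$ and $p$ is the betrayal parameter. A strategy of pool $i \in \{1,2\}$ is a number $x_i \in [0, m_i]$, and at the strategy profile $(x_1, x_2)$ the average rewards of the two pools are $$r_1(x_1,x_2) = \frac{m_1 m_2 + m_1 x_1 + p m_2 x_2 - (1-p)x_1^2 - (1-p)x_1x_2}{\bigl(m-(1-p)(x_1+x_2)\bigr)\bigl(m_1m_2+m_1x_1+m_2x_2\bigr)},$$ $$r_2(x_1,x_2) = \frac{m_1 m_2 + m_2 x_2 + p m_1 x_1 - (1-p)x_2^2 - (1-p)x_1x_2}{\bigl(m-(1-p)(x_1+x_2)\bigr)\bigl(m_1m_2+m_1x_1+m_2x_2\bigr)},$$ where $r_1 = r_2 = 0$ if $m-(1-p)(x_1+x_2) = 0$ (this happens only if $m = m_1 + m_2$, $p = 0$ and $(x_1,x_2) = (m_1,m_2)$). A profile $(x_1^*, x_2^*) \in [0,m_1]\times[0,m_2]$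 is a pure Nash equilibrium if $r_1(x_1, x_2^*) \le r_1(x_1^*, x_2^*)$ for all $x_1 \in [0,m_1]$ and $r_2(x_1^*, x_2) \le r_2(x_1^*, x_2^*)$ for all $x_2 \in [0,m_2]$. Theorem. Every such game has exactly one pure Nash equilibrium. -/

import Mathlib

/-- The parameters of the two-player miner's dilemma game with betrayal: the total mining power `m`
of the system, the mining powers `m₁`, `m₂` of the two pools, and the betrayal parameter
`p ∈ [0,1)`. The remaining power `m - m₁ - m₂` is nonnegative. -/
structure MinersDilemma where
  m : ℝ
  m₁ : ℝ
  m₂ : ℝ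
  p : ℝ
  m₁_pos : 0 < m₁
  m₂_pos : 0 < m₂
  add_le : m₁ + m₂ ≤ m
  p_nonneg : 0 ≤ p
  p_lt_one : p < 1

namespace MinersDilemma

noncomputable section

/-- The total effective mining power of the system at the strategy profile `(x₁, x₂)`. -/
def effective (G : MinersDilemma) (x₁ x₂ : ℝ) : ℝ :=
  G.m - (1 - G.p) * (x₁ + x₂)

/-- The direct reward of pool 1. If the effective mining power vanishes, nobody is mining and the
direct reward is `0`, which is the value that Lean gives to a quotient by `0`. -/
def R₁ (G : MinersDilemma) (x₁ x₂ : ℝ) : ℝ :=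
  (G.m₁ - x₁ + G.p * x₂) / G.effective x₁ x₂

/-- The direct reward of pool 2, with the same convention. -/
def R₂ (G : MinersDilemma) (x₁ x₂ : ℝ) : ℝ :=
  (G.m₂ - x₂ + G.p * x₁) / G.effective x₁ x₂

/-- The average reward of pool 1. If the effective mining power vanishes, it is `0`. -/
def r₁ (G : MinersDilemma) (x₁ x₂ : ℝ) : ℝ :=
  (G.m₁ * G.m₂ + G.m₁ * x₁ + G.p * G.m₂ * x₂ - (1 - G.p) * x₁ ^ 2 - (1 - G.p) * x₁ * x₂) /
    (G.effective x₁ x₂ * (G.m₁ * G.m₂ + G.m₁ * x₁ + G.m₂ * x₂))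

/-- The average reward of pool 2. If the effective mining power vanishes, it is `0`. -/
def r₂ (G : MinersDilemma) (x₁ x₂ : ℝ) : ℝ :=
  (G.m₁ * G.m₂ + G.m₂ * x₂ + G.p * G.m₁ * x₁ - (1 - G.p) * x₂ ^ 2 - (1 - G.p) * x₁ * x₂) /
    (G.effective x₁ x₂ * (G.m₁ * G.m₂ + G.m₁ * x₁ + G.m₂ * x₂))

/-- The closed forms `r₁`, `r₂` are the unique solution of the system that defines the average
rewards: each pool shares its direct reward and the income of its infiltrators equally among its
own power and the power infiltrating it. -/
theorem rewards_iff (G : MinersDilemma) {x₁ x₂ : ℝ} (h₁ : 0 ≤ x₁) (h₂ : 0 ≤ x₂) (u v : ℝ) :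
    (u = (G.R₁ x₁ x₂ + x₁ * v) / (G.m₁ + x₂) ∧ v = (G.R₂ x₁ x₂ + x₂ * u) / (G.m₂ + x₁)) ↔
      (u = G.r₁ x₁ x₂ ∧ v = G.r₂ x₁ x₂) := by
  have a := G.m₁_pos
  have b := G.m₂_pos
  have hD : 0 < G.m₁ * G.m₂ + G.m₁ * x₁ + G.m₂ * x₂ := by positivity
  have e₁ : G.r₁ x₁ x₂ = (G.R₁ x₁ x₂ * (G.m₂ + x₁) + x₁ * G.R₂ x₁ x₂) /
      (G.m₁ * G.m₂ + G.m₁ * x₁ + G.m₂ * x₂) := by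
    unfold r₁ R₁ R₂
    rw [← div_div]
    congr 1
    ring
  have e₂ : G.r₂ x₁ x₂ = (G.R₂ x₁ x₂ * (G.m₁ + x₂) + x₂ * G.R₁ x₁ x₂) /
      (G.m₁ * G.m₂ + G.m₁ * x₁ + G.m₂ * x₂) := by
    unfold r₂ R₁ R₂
    rw [← div_div]
    congr 1
    ring
  have p₁ : 0 < G.m₁ + x₂ := by positivity
  have p₂ : 0 < G.m₂ + x₁ := by positivity
  rw [e₁, e₂, eq_div_iff p₁.ne', eq_div_iff p₂.ne', eq_div_iff hD.ne', eq_div_iff hD.ne']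
  constructor
  · rintro ⟨hu, hv⟩
    exact ⟨by linear_combination (G.m₂ + x₁) * hu + x₁ * hv,
      by linear_combination (G.m₁ + x₂) * hv + x₂ * hu⟩
  · rintro ⟨hu, hv⟩
    constructor
    · apply mul_right_cancel₀ hD.ne'
      linear_combination (G.m₁ + x₂) * hu - x₁ * hv
    · apply mul_right_cancel₀ hD.ne'
      linear_combination (G.m₂ + x₁) * hv - x₂ * hu

/-- `x = (x₁*, x₂*)` is a pure Nash equilibrium: it is a strategy profile, i.e. a point of
`[0, m₁] × [0, m₂]`, and neither pool can increase its average reward by changing only its own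
strategy. -/
def IsPureNash (G : MinersDilemma) (x : ℝ × ℝ) : Prop :=
  x.1 ∈ Set.Icc 0 G.m₁ ∧ x.2 ∈ Set.Icc 0 G.m₂ ∧
    (∀ y ∈ Set.Icc 0 G.m₁, G.r₁ y x.2 ≤ G.r₁ x.1 x.2) ∧
    (∀ y ∈ Set.Icc 0 G.m₂, G.r₂ x.1 y ≤ G.r₂ x.1 x.2)

end

end MinersDilemma

namespace MinersDilemma

noncomputable section

open Set Filter Topology

/-! Up to a positive factor, the derivative of each reward in the pool's own strategy is a marginal
that strictly decreases in that strategy (`strictAntiOn_marginal`). At full infiltration it is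
negative unless the effective power vanishes (`marginal_right_neg`), so equilibria are exactly the
solutions of the first-order conditions (`isPureNash_iff`).

Uniqueness rests on weighting the marginals by `m₁` and `m₂`. Put `g = √(m₁ m₂)`. The weighted sum
is negative where `x + y > g` and the effective power is positive (`weighted_marginal_neg`), so
critical points outside the triangle `x + y ≤ g` lie on an axis. On the triangle the weighted pair
is strictly monotone (`strict_monotone_marginal`), as in Rosen's diagonal strict concavity, so its
variational inequality has at most one solution. A critical point in the triangle is such a
solution; one beyond it on an axis becomes one when cut back to sum `g` (`solvesVI_axis`). Comparing
these solutions leaves a single critical point.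

Existence: the first-order reply of pool 1 is continuous, and the intermediate value theorem is
applied to the marginal of pool 2 along it. -/

/-! ### Marginals and their derivatives. -/

/-- The game in which the two pools exchange their roles. -/
def swap (G : MinersDilemma) : MinersDilemma where
  m := G.m
  m₁ := G.m₂
  m₂ := G.m₁
  p := G.p
  m₁_pos := G.m₂_pos
  m₂_pos := G.m₁_pos
  add_le := by linarith [G.add_le]
  p_nonneg := G.p_nonneg
  p_lt_one := G.p_lt_one

theorem r₂_eq_swap (G : MinersDilemma) (x y : ℝ) : G.r₂ x y = G.swap.r₁ y x := by
  unfold r₂ r₁ effective swap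
  simp only
  congr 1 <;> ring

theorem effective_swap (G : MinersDilemma) (x y : ℝ) :
    G.swap.effective y x = G.effective x y := by
  unfold effective swap
  simp only
  ring

/-- The determinant of the linear system that defines the average rewards. -/
def den (G : MinersDilemma) (x y : ℝ) : ℝ := G.m₁ * G.m₂ + G.m₁ * x + G.m₂ * y

theorem den_swap (G : MinersDilemma) (x y : ℝ) : G.swap.den y x = G.den x y := by
  unfold den swap
  simp only
  ring

theorem den_pos (G : MinersDilemma) {x y : ℝ} (hx : 0 ≤ x) (hy : 0 ≤ y) : 0 < G.den x y := by
  have := G.m₁_pos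
  have := G.m₂_pos
  unfold den
  positivity

/-- The derivative of `r₁` with respect to the first strategy, up to the positive factor
`(1 - p) / effective ^ 2`. -/
def marginal (G : MinersDilemma) (x y : ℝ) : ℝ :=
  1 - (1 - G.p) * (x ^ 2 + x * y + G.m₂ * y) / G.den x y -
    G.effective x y * (G.m₁ * x ^ 2 + 2 * G.m₂ * x * (G.m₁ + y) + G.m₂ * y ^ 2) / G.den x y ^ 2

/-- The coefficient that governs the curvature of the reward of pool 1 in its own strategy. -/
def curv (G : MinersDilemma) (y : ℝ) : ℝ := G.m₂ * (G.m₁ + y) ^ 2 - G.m₁ * y ^ 2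

theorem hasDerivAt_r₁ (G : MinersDilemma) {x y : ℝ} (hD : G.den x y ≠ 0)
    (hE : G.effective x y ≠ 0) :
    HasDerivAt (fun t => G.r₁ t y) ((1 - G.p) * G.marginal x y / G.effective x y ^ 2) x := by
  have hid := hasDerivAt_id' x
  have hn : HasDerivAt (fun t => G.m₁ * G.m₂ + G.m₁ * t + G.p * G.m₂ * y - (1 - G.p) * t ^ 2
      - (1 - G.p) * t * y) (G.m₁ - (1 - G.p) * (2 * x) - (1 - G.p) * y) x := by
    have := ((((hid.const_mul G.m₁).const_add (G.m₁ * G.m₂)).add_const (G.p * G.m₂ * y)).sub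
      ((hid.pow 2).const_mul (1 - G.p))).sub ((hid.const_mul (1 - G.p)).mul_const y)
    refine this.congr_deriv ?_
    simp
  have he : HasDerivAt (fun t => G.effective t y) (-(1 - G.p)) x := by
    refine (((hid.add_const y).const_mul (1 - G.p)).const_sub G.m).congr_deriv ?_
    simp
  have hd : HasDerivAt (fun t => G.den t y) G.m₁ x := by
    refine (((hid.const_mul G.m₁).const_add (G.m₁ * G.m₂)).add_const (G.m₂ * y)).congr_deriv ?_
    simp
  refine (hn.div (he.mul hd) (mul_ne_zero hE hD)).congr_deriv ?_
  unfold marginal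
  simp only [Pi.mul_apply]
  field_simp
  unfold den effective
  ring

/-- The last bracket is antisymmetric under exchanging the pools. It therefore cancels in the
weighted sum of both marginals, leaving `(x + y) ^ 2 - m₁ m₂` as the only cross coefficient. -/
theorem hasDerivAt_marginal_line (G : MinersDilemma) (x y u v t : ℝ)
    (hD : G.den (x + t * u) (y + t * v) ≠ 0) :
    HasDerivAt (fun t => G.marginal (x + t * u) (y + t * v))
      (G.m₂ / G.den (x + t * u) (y + t * v) ^ 3 *
        (-2 * G.effective (x + t * u) (y + t * v) * G.curv (y + t * v) * u +
          ((1 - G.p) * ((x + t * u + (y + t * v)) ^ 2 - G.m₁ * G.m₂) *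
              G.den (x + t * u) (y + t * v) -
            2 * G.effective (x + t * u) (y + t * v) *
              (G.m₁ * G.m₂ * (y + t * v - (x + t * u)) +
                (G.m₁ - G.m₂) * (x + t * u) * (y + t * v))) * v)) t := by
  have hx : HasDerivAt (fun t => x + t * u) u t := by
    simpa using ((hasDerivAt_id' t).mul_const u).const_add x
  have hy : HasDerivAt (fun t => y + t * v) v t := by
    simpa using ((hasDerivAt_id' t).mul_const v).const_add y
  have he : HasDerivAt (fun t => G.effective (x + t * u) (y + t * v)) (-((1 - G.p) * (u + v))) t :=
    ((hx.add hy).const_mul (1 - G.p)).const_sub G.m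
  have hd : HasDerivAt (fun t => G.den (x + t * u) (y + t * v)) (G.m₁ * u + G.m₂ * v) t :=
    ((hx.const_mul G.m₁).const_add (G.m₁ * G.m₂)).add (hy.const_mul G.m₂)
  have hk := (((hx.pow 2).add (hx.mul hy)).add (hy.const_mul G.m₂)).const_mul (1 - G.p)
  have hp := (((hx.pow 2).const_mul G.m₁).add
    ((hx.const_mul (2 * G.m₂)).mul (hy.const_add G.m₁))).add ((hy.pow 2).const_mul G.m₂)
  refine (((hk.div hd hD).const_sub 1).sub
    ((he.mul hp).div (hd.pow 2) (pow_ne_zero 2 hD))).congr_deriv ?_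
  simp only [Pi.mul_apply, Pi.add_apply, Pi.pow_apply, Nat.cast_ofNat]
  generalize x + t * u = X at *
  generalize y + t * v = Y at *
  field_simp
  unfold den effective curv
  ring

/-! ### Signs: curvature, effective power, and the marginal at full infiltration. -/

theorem curv_pos_of_le (G : MinersDilemma) {y : ℝ} (hy : 0 ≤ y) (hyb : y ≤ G.m₂) :
    0 < G.curv y := by
  have a := G.m₁_pos
  have b := G.m₂_pos
  have h : G.curv y = G.m₁ ^ 2 * G.m₂ + G.m₁ * G.m₂ * y + G.m₂ * y ^ 2 +
      G.m₁ * y * (G.m₂ - y) := by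
    unfold curv
    ring
  have : 0 ≤ G.m₂ - y := by linarith
  rw [h]
  positivity

/-- Needed because the triangle `x + y ≤ √(m₁ m₂)` may stick out of the strategy rectangle, so `y ≤
m₂` can fail there. -/
theorem curv_pos_of_sq_le (G : MinersDilemma) {y : ℝ} (hy : 0 ≤ y)
    (hyb : y ^ 2 ≤ G.m₁ * G.m₂) : 0 < G.curv y := by
  have a := G.m₁_pos
  have b := G.m₂_pos
  have h : G.curv y = G.m₂ * y * (2 * G.m₁ + y) + G.m₁ * (G.m₁ * G.m₂ - y ^ 2) := by
    unfold curv
    ring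
  rcases hy.eq_or_lt with rfl | hy
  · rw [h]
    simp
    positivity
  · have : 0 ≤ G.m₁ * G.m₂ - y ^ 2 := by linarith
    rw [h]
    positivity

theorem effective_pos (G : MinersDilemma) {x y : ℝ} (hx : 0 ≤ x) (hy : 0 ≤ y)
    (h : x + y < G.m₁ + G.m₂) : 0 < G.effective x y := by
  have := G.add_le
  have := mul_nonneg G.p_nonneg (add_nonneg hx hy)
  unfold effective
  linarith

theorem continuousOn_marginal (G : MinersDilemma) :
    ContinuousOn (fun z : ℝ × ℝ => G.marginal z.1 z.2) (Ici 0 ×ˢ Ici 0) := by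
  have hD : ContinuousOn (fun z : ℝ × ℝ => G.den z.1 z.2) (Ici 0 ×ˢ Ici 0) := by
    unfold den
    fun_prop
  have h0 : ∀ z ∈ (Ici 0 ×ˢ Ici 0 : Set (ℝ × ℝ)), G.den z.1 z.2 ≠ 0 :=
    fun z hz => (G.den_pos hz.1 hz.2).ne'
  unfold marginal effective
  refine (continuousOn_const.sub (ContinuousOn.div (by fun_prop) hD h0)).sub
    (ContinuousOn.div (by fun_prop) (hD.pow 2) fun z hz => pow_ne_zero 2 (h0 z hz))

theorem strictAntiOn_marginal (G : MinersDilemma) {y : ℝ} (hy : y ∈ Icc 0 G.m₂) :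
    StrictAntiOn (fun x => G.marginal x y) (Icc 0 G.m₁) := by
  refine strictAntiOn_of_deriv_neg (convex_Icc _ _) ?_ ?_
  · exact G.continuousOn_marginal.comp (f := fun x => (x, y)) (by fun_prop)
      fun x hx => ⟨hx.1, hy.1⟩
  · intro x hx
    rw [interior_Icc] at hx
    have hD := G.den_pos hx.1.le hy.1
    have h := G.hasDerivAt_marginal_line 0 y 1 0 x (by simpa using hD.ne')
    simp only [zero_add, mul_one, mul_zero, add_zero] at h
    rw [h.deriv]
    have hE := G.effective_pos hx.1.le hy.1 (by linarith [hx.2, hy.2])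
    have hA := G.curv_pos_of_le hy.1 hy.2
    have hb := G.m₂_pos
    have : 0 < G.m₂ / G.den x y ^ 3 * (2 * G.effective x y * G.curv y) := by positivity
    linarith

/-- Grouped by `p`, `m₂ - y` and `m - m₁ - m₂`, which are nonnegative in the game. All three vanish
only where the effective power does, and there the marginal is `0`. -/
theorem marginal_right_mul (G : MinersDilemma) {y : ℝ} (hD : G.den G.m₁ y ≠ 0) :
    G.marginal G.m₁ y * G.den G.m₁ y ^ 2 =
      -(G.p * (G.m₁ ^ 2 * G.m₂ ^ 2 + G.m₁ ^ 3 * G.m₂ + G.m₁ * G.m₂ * y ^ 2) +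
        (1 - G.p) * (G.m₂ - y) * (G.m₁ ^ 2 * G.m₂ + G.m₁ * G.m₂ * y + G.m₂ * y ^ 2) +
        (G.m - G.m₁ - G.m₂) *
          (G.m₁ ^ 3 + 2 * G.m₂ * G.m₁ * (G.m₁ + y) + G.m₂ * y ^ 2)) := by
  unfold marginal
  field_simp
  unfold den effective
  ring

theorem marginal_right_nonpos (G : MinersDilemma) {y : ℝ} (hy : y ∈ Icc 0 G.m₂) :
    G.marginal G.m₁ y ≤ 0 := by
  have a := G.m₁_pos
  have b := G.m₂_pos
  have p := G.p_nonneg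
  have hD := G.den_pos a.le hy.1
  have h := G.marginal_right_mul hD.ne'
  have q : 0 ≤ 1 - G.p := by linarith [G.p_lt_one]
  have e : 0 ≤ G.m - G.m₁ - G.m₂ := by linarith [G.add_le]
  have f : 0 ≤ G.m₂ - y := by linarith [hy.2]
  have hy0 := hy.1
  refine nonpos_of_mul_nonpos_left (b := G.den G.m₁ y ^ 2) ?_ (by positivity)
  rw [h, neg_nonpos]
  positivity

theorem marginal_right_neg (G : MinersDilemma) {y : ℝ} (hy : y ∈ Icc 0 G.m₂)
    (hE : 0 < G.effective G.m₁ y) : G.marginal G.m₁ y < 0 := by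
  have a := G.m₁_pos
  have b := G.m₂_pos
  have p := G.p_nonneg
  have hD := G.den_pos a.le hy.1
  have h := G.marginal_right_mul hD.ne'
  have q : 0 < 1 - G.p := by linarith [G.p_lt_one]
  have e : 0 ≤ G.m - G.m₁ - G.m₂ := by linarith [G.add_le]
  have f : 0 ≤ G.m₂ - y := by linarith [hy.2]
  have hy0 := hy.1
  have hE' : 0 < (G.m - G.m₁ - G.m₂) + G.p * (G.m₁ + G.m₂) + (1 - G.p) * (G.m₂ - y) := by
    have : G.effective G.m₁ y =
        (G.m - G.m₁ - G.m₂) + G.p * (G.m₁ + G.m₂) + (1 - G.p) * (G.m₂ - y) := by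
      unfold effective
      ring
    rwa [← this]
  refine neg_of_mul_neg_left (b := G.den G.m₁ y ^ 2) ?_ (by positivity)
  rw [h, neg_lt_zero]
  rcases e.eq_or_lt with e0 | e0
  · rcases p.eq_or_lt with p0 | p0
    · rw [← e0, ← p0] at hE' ⊢
      have : 0 < G.m₂ - y := by linarith
      simp only [zero_mul, zero_add, add_zero, sub_zero, one_mul]
      positivity
    · positivity
  · positivity

/-! ### Weighted marginals and their strict monotonicity. -/

/-- The combination of the two marginals in which all but one term cancel. -/
theorem weighted_marginal (G : MinersDilemma) {x y : ℝ} (hD : G.den x y ≠ 0) :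
    G.m₁ * G.marginal x y + G.m₂ * G.swap.marginal y x =
      G.m₁ + G.m₂ - G.m +
        G.effective x y * (G.m₁ * G.m₂ * (G.m₁ * G.m₂ - (x + y) ^ 2)) / G.den x y ^ 2 := by
  unfold marginal
  rw [den_swap, effective_swap]
  simp only [swap]
  field_simp
  unfold den effective
  ring

theorem weighted_marginal_neg (G : MinersDilemma) {x y : ℝ} (hx : 0 ≤ x) (hy : 0 ≤ y)
    (hE : 0 < G.effective x y) (hs : G.m₁ * G.m₂ < (x + y) ^ 2) :
    G.m₁ * G.marginal x y + G.m₂ * G.swap.marginal y x < 0 := by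
  have hD := G.den_pos hx hy
  have a := G.m₁_pos
  have b := G.m₂_pos
  have hs : 0 < (x + y) ^ 2 - G.m₁ * G.m₂ := by linarith
  have : 0 < G.effective x y * (G.m₁ * G.m₂ * ((x + y) ^ 2 - G.m₁ * G.m₂)) / G.den x y ^ 2 := by
    positivity
  rw [G.weighted_marginal hD.ne', ← neg_sub ((x + y) ^ 2), mul_neg, mul_neg, neg_div]
  linarith [G.add_le]

/-- The bound splits into one factor per pool: `den` is at most `(m₁ + y) (m₂ + x)`, and `τ = m₁ m₂
- (x + y) ^ 2` is at most both `m₁ m₂ - y ^ 2` and `m₁ m₂ - x ^ 2`. -/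
theorem sq_mul_den_le (G : MinersDilemma) {x y : ℝ} (hx : 0 ≤ x) (hy : 0 ≤ y)
    (hs : (x + y) ^ 2 ≤ G.m₁ * G.m₂) :
    ((x + y) ^ 2 - G.m₁ * G.m₂) ^ 2 * G.den x y ^ 2 ≤
      G.m₁ * G.m₂ * (G.curv y * G.swap.curv x) := by
  have a := G.m₁_pos
  have b := G.m₂_pos
  set τ := G.m₁ * G.m₂ - (x + y) ^ 2 with hτ
  have hτ0 : 0 ≤ τ := by linarith
  have key : ∀ c d z : ℝ, 0 < c → 0 < d → 0 ≤ z → τ ≤ c * d - z ^ 2 →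
      (c + z) ^ 2 * τ ≤ c * (d * (c + z) ^ 2 - c * z ^ 2) := by
    intro c d z hc hd hz h
    have h1 : (c + z) ^ 2 * τ ≤ (c + z) ^ 2 * (c * d - z ^ 2) := by gcongr
    have h2 : 0 ≤ z ^ 2 * (2 * c * z + z ^ 2) := by positivity
    linarith
  have h1 := key G.m₁ G.m₂ y a b hy (by nlinarith)
  have h2 := key G.m₂ G.m₁ x b a hx (by nlinarith)
  have h3 : G.den x y ≤ (G.m₁ + y) * (G.m₂ + x) := by
    unfold den
    nlinarith [mul_nonneg hx hy]
  calc ((x + y) ^ 2 - G.m₁ * G.m₂) ^ 2 * G.den x y ^ 2 = τ ^ 2 * G.den x y ^ 2 := by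
        rw [hτ]
        ring
    _ ≤ τ ^ 2 * ((G.m₁ + y) * (G.m₂ + x)) ^ 2 := by
        have := (G.den_pos hx hy).le
        gcongr
    _ = ((G.m₁ + y) ^ 2 * τ) * ((G.m₂ + x) ^ 2 * τ) := by ring
    _ ≤ (G.m₁ * G.curv y) * (G.m₂ * G.swap.curv x) :=
        mul_le_mul h1 h2 (by positivity) (le_trans (by positivity) h1)
    _ = _ := by ring

/-- By the arithmetic-geometric mean inequality `m ≥ m₁ + m₂ ≥ 2g`, while `x + y ≤ g`; hence the
effective power is at least `(1 + p) g`, which exceeds what is needed. -/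
theorem sq_le_effective_sq (G : MinersDilemma) {x y : ℝ}
    (hs : (x + y) ^ 2 ≤ G.m₁ * G.m₂) :
    0 < G.effective x y ∧ (1 - G.p) ^ 2 * (G.m₁ * G.m₂) ≤ G.effective x y ^ 2 := by
  have a := G.m₁_pos
  have b := G.m₂_pos
  have hq : 0 < 1 - G.p := by linarith [G.p_lt_one]
  have hab : 0 < G.m₁ * G.m₂ := by positivity
  set g := √(G.m₁ * G.m₂) with hg
  have hg2 : g ^ 2 = G.m₁ * G.m₂ := Real.sq_sqrt hab.le
  have hg0 : 0 < g := Real.sqrt_pos.2 hab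
  have hsg : x + y ≤ g := Real.le_sqrt_of_sq_le hs
  have hag : 2 * g ≤ G.m₁ + G.m₂ := by
    refine abs_le_of_sq_le_sq' ?_ (by positivity) |>.2
    nlinarith [sq_nonneg (G.m₁ - G.m₂)]
  have hE : (1 - G.p) * g ≤ G.effective x y := by
    unfold effective
    nlinarith [G.add_le, G.p_nonneg, mul_nonneg hq.le (sub_nonneg.2 hsg),
      mul_nonneg G.p_nonneg hg0.le]
  have h0 : 0 < (1 - G.p) * g := by positivity
  refine ⟨h0.trans_le hE, ?_⟩
  rw [← hg2, ← mul_pow]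
  gcongr

theorem quadForm_pos {A B C u v : ℝ} (hA : 0 < A) (h : C ^ 2 < 4 * (A * B))
    (huv : u ≠ 0 ∨ v ≠ 0) : 0 < A * u ^ 2 + B * v ^ 2 - C * u * v := by
  have h1 : 4 * A * (A * u ^ 2 + B * v ^ 2 - C * u * v) =
      (2 * A * u - C * v) ^ 2 + (4 * (A * B) - C ^ 2) * v ^ 2 := by ring
  have h2 : 0 < 4 * (A * B) - C ^ 2 := by linarith
  refine pos_of_mul_pos_right (a := 4 * A) ?_ (by positivity)
  rw [h1]
  by_cases hv : v = 0
  · subst hv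
    have hu : u ≠ 0 := by simpa using huv
    simp
    positivity
  · positivity

/-- This form is a negative multiple of the derivative of the weighted marginals, paired with `(u,
v)`, in the direction `(u, v)`. The two preceding bounds make its discriminant negative. -/
theorem weighted_deriv_neg (G : MinersDilemma) {x y u v : ℝ} (hx : 0 ≤ x) (hy : 0 ≤ y)
    (hs : (x + y) ^ 2 ≤ G.m₁ * G.m₂) (huv : u ≠ 0 ∨ v ≠ 0) :
    0 < G.effective x y * G.curv y * u ^ 2 + G.effective x y * G.swap.curv x * v ^ 2 -
      (1 - G.p) * ((x + y) ^ 2 - G.m₁ * G.m₂) * G.den x y * u * v := by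
  obtain ⟨hE, hE2⟩ := G.sq_le_effective_sq hs
  have hA := G.curv_pos_of_sq_le hy (by nlinarith)
  have hB := G.swap.curv_pos_of_sq_le hx
    (by simp only [swap]; nlinarith)
  refine quadForm_pos (by positivity) ?_ huv
  have h1 := G.sq_mul_den_le hx hy hs
  have hAB := mul_pos hA hB
  calc ((1 - G.p) * ((x + y) ^ 2 - G.m₁ * G.m₂) * G.den x y) ^ 2
      = (1 - G.p) ^ 2 * (((x + y) ^ 2 - G.m₁ * G.m₂) ^ 2 * G.den x y ^ 2) := by ring
    _ ≤ (1 - G.p) ^ 2 * (G.m₁ * G.m₂ * (G.curv y * G.swap.curv x)) := by gcongr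
    _ = (1 - G.p) ^ 2 * (G.m₁ * G.m₂) * (G.curv y * G.swap.curv x) := by ring
    _ ≤ G.effective x y ^ 2 * (G.curv y * G.swap.curv x) := by gcongr
    _ < 4 * (G.effective x y ^ 2 * (G.curv y * G.swap.curv x)) := by
        have := mul_pos (pow_pos hE 2) hAB
        linarith
    _ = _ := by ring

/-- The weighted pair of marginals is strictly monotone (decreasing) on the triangle
`x + y ≤ √(m₁ m₂)`. -/
theorem strict_monotone_marginal (G : MinersDilemma) {x y x' y' g : ℝ}
    (hg : g ^ 2 ≤ G.m₁ * G.m₂) (hx : 0 ≤ x) (hy : 0 ≤ y) (hx' : 0 ≤ x') (hy' : 0 ≤ y')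
    (hs : x + y ≤ g) (hs' : x' + y' ≤ g) (hne : x' - x ≠ 0 ∨ y' - y ≠ 0) :
    G.m₁ * (x' - x) * G.marginal x' y' + G.m₂ * (y' - y) * G.swap.marginal y' x' <
      G.m₁ * (x' - x) * G.marginal x y + G.m₂ * (y' - y) * G.swap.marginal y x := by
  set u := x' - x with hu
  set v := y' - y with hv
  let W : ℝ → ℝ := fun t => G.m₁ * u * G.marginal (x + t * u) (y + t * v) +
    G.m₂ * v * G.swap.marginal (y + t * v) (x + t * u)
  have hX : ∀ t ∈ Icc (0 : ℝ) 1, 0 ≤ x + t * u := fun t ht => by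
    have h1 := mul_nonneg (sub_nonneg.2 ht.2) hx
    have h2 := mul_nonneg ht.1 hx'
    rw [hu]
    linarith
  have hY : ∀ t ∈ Icc (0 : ℝ) 1, 0 ≤ y + t * v := fun t ht => by
    have h1 := mul_nonneg (sub_nonneg.2 ht.2) hy
    have h2 := mul_nonneg ht.1 hy'
    rw [hv]
    linarith
  have hS : ∀ t ∈ Icc (0 : ℝ) 1, x + t * u + (y + t * v) ≤ g := fun t ht => by
    have h1 := mul_nonneg (sub_nonneg.2 ht.2) (sub_nonneg.2 hs)
    have h2 := mul_nonneg ht.1 (sub_nonneg.2 hs')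
    rw [hu, hv]
    linarith
  have hW : ∀ t ∈ Icc (0 : ℝ) 1, ∃ d < 0, HasDerivAt W d t := by
    intro t ht
    have hD := G.den_pos (hX t ht) (hY t ht)
    have h1 := G.hasDerivAt_marginal_line x y u v t hD.ne'
    have h2 := G.swap.hasDerivAt_marginal_line y x v u t (by rw [den_swap]; exact hD.ne')
    have hpos := G.weighted_deriv_neg (u := u) (v := v) (hX t ht) (hY t ht)
      ((pow_le_pow_left₀ (add_nonneg (hX t ht) (hY t ht)) (hS t ht) 2).trans hg) hne
    refine ⟨_, ?_, (h1.const_mul (G.m₁ * u)).add (h2.const_mul (G.m₂ * v))⟩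
    rw [den_swap, effective_swap]
    have a := G.m₁_pos
    have b := G.m₂_pos
    have hpos' := mul_pos (show 0 < 2 * G.m₁ * G.m₂ / G.den (x + t * u) (y + t * v) ^ 3 by
      positivity) hpos
    rw [← neg_pos]
    refine hpos'.trans_eq ?_
    rw [show G.swap.m₁ = G.m₂ from rfl, show G.swap.m₂ = G.m₁ from rfl,
      show G.swap.p = G.p from rfl]
    ring
  have hanti : StrictAntiOn W (Icc 0 1) := by
    refine strictAntiOn_of_deriv_neg (convex_Icc _ _) ?_ ?_
    · intro t ht
      obtain ⟨d, -, h⟩ := hW t ht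
      exact h.continuousAt.continuousWithinAt
    · intro t ht
      obtain ⟨d, hd, h⟩ := hW t (interior_subset ht)
      rwa [h.deriv]
  have := hanti (left_mem_Icc.2 zero_le_one) (right_mem_Icc.2 zero_le_one) zero_lt_one
  simpa [W, hu, hv] using this

/-! ### Best replies and first-order conditions. -/

theorem deriv_nonneg_of_le_left {f : ℝ → ℝ} {f' c x : ℝ} (hf : HasDerivAt f f' x) (hc : c < x)
    (h : ∀ t ∈ Ioo c x, f t ≤ f x) : 0 ≤ f' := by
  have hs := (hasDerivWithinAt_iff_tendsto_slope' (s := Iio x) self_notMem_Iio).1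
    hf.hasDerivWithinAt
  refine ge_of_tendsto hs ?_
  filter_upwards [Ioo_mem_nhdsLT hc] with t ht
  rw [slope_def_field]
  exact div_nonneg_of_nonpos (by linarith [h t ht]) (by linarith [ht.2])

theorem deriv_nonpos_of_le_right {f : ℝ → ℝ} {f' c x : ℝ} (hf : HasDerivAt f f' x) (hc : x < c)
    (h : ∀ t ∈ Ioo x c, f t ≤ f x) : f' ≤ 0 := by
  have hs := (hasDerivWithinAt_iff_tendsto_slope' (s := Ioi x) self_notMem_Ioi).1
    hf.hasDerivWithinAt
  refine le_of_tendsto hs ?_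
  filter_upwards [Ioo_mem_nhdsGT hc] with t ht
  rw [slope_def_field]
  exact div_nonpos_of_nonpos_of_nonneg (by linarith [h t ht]) (by linarith [ht.1])

theorem r₁_zero_pos (G : MinersDilemma) {y : ℝ} (hy : y ∈ Icc 0 G.m₂) : 0 < G.r₁ 0 y := by
  have a := G.m₁_pos
  have b := G.m₂_pos
  have p := G.p_nonneg
  have hy0 := hy.1
  have hE := G.effective_pos le_rfl hy.1 (by linarith [hy.2])
  unfold r₁
  simp only [mul_zero, add_zero, zero_mul, sub_zero, ne_eq, OfNat.ofNat_ne_zero,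
    not_false_eq_true, zero_pow]
  positivity

/-- A pool never infiltrates with its whole power in a best reply. -/
theorem lt_of_isBestReply (G : MinersDilemma) {x y : ℝ} (hy : y ∈ Icc 0 G.m₂)
    (hx : x ∈ Icc 0 G.m₁) (h : ∀ t ∈ Icc 0 G.m₁, G.r₁ t y ≤ G.r₁ x y) : x < G.m₁ := by
  refine hx.2.lt_of_ne ?_
  rintro rfl
  have a := G.m₁_pos
  have hq : 0 < 1 - G.p := by linarith [G.p_lt_one]
  have hE : 0 ≤ G.effective G.m₁ y := by
    have := mul_nonneg G.p_nonneg (add_nonneg hx.1 hy.1)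
    unfold effective
    linarith [G.add_le, hy.2]
  rcases hE.eq_or_lt with hE | hE
  -- At the degenerate corner the marginal gives no information, but the reward there is `0` by
  -- convention and not infiltrating earns more.
  · have h0 := h 0 ⟨le_rfl, hx.1⟩
    have h1 := G.r₁_zero_pos hy
    have h2 : G.r₁ G.m₁ y = 0 := by
      unfold r₁
      rw [← hE, zero_mul, div_zero]
    linarith
  · have hd := G.hasDerivAt_r₁ (G.den_pos hx.1 hy.1).ne' hE.ne'
    have h1 := deriv_nonneg_of_le_left hd a fun t ht => h t ⟨ht.1.le, ht.2.le⟩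
    have h2 := G.marginal_right_neg hy hE
    have : (1 - G.p) * G.marginal G.m₁ y / G.effective G.m₁ y ^ 2 < 0 :=
      div_neg_of_neg_of_pos (mul_neg_of_pos_of_neg hq h2) (by positivity)
    linarith

/-- Best replies are characterized by the first-order conditions. -/
theorem isBestReply_iff (G : MinersDilemma) {x y : ℝ} (hy : y ∈ Ico 0 G.m₂)
    (hx : x ∈ Ico 0 G.m₁) :
    (∀ t ∈ Icc 0 G.m₁, G.r₁ t y ≤ G.r₁ x y) ↔
      G.marginal x y ≤ 0 ∧ (0 < x → G.marginal x y = 0) := by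
  have hq : 0 < 1 - G.p := by linarith [G.p_lt_one]
  have hE : ∀ t ∈ Icc 0 G.m₁, 0 < G.effective t y := fun t ht =>
    G.effective_pos ht.1 hy.1 (by linarith [ht.2, hy.2])
  have hd : ∀ t ∈ Icc 0 G.m₁, HasDerivAt (fun t => G.r₁ t y)
      ((1 - G.p) * G.marginal t y / G.effective t y ^ 2) t := fun t ht =>
    G.hasDerivAt_r₁ (G.den_pos ht.1 hy.1).ne' (hE t ht).ne'
  have hxI : x ∈ Icc 0 G.m₁ := ⟨hx.1, hx.2.le⟩
  have hEx := hE x hxI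
  constructor
  · intro h
    have h1 : G.marginal x y ≤ 0 := by
      have := deriv_nonpos_of_le_right (hd x hxI) hx.2
        fun t ht => h t ⟨hx.1.trans ht.1.le, ht.2.le⟩
      rw [div_le_iff₀ (by positivity), zero_mul] at this
      exact nonpos_of_mul_nonpos_right this hq
    refine ⟨h1, fun hx0 => le_antisymm h1 ?_⟩
    have := deriv_nonneg_of_le_left (hd x hxI) hx0
      fun t ht => h t ⟨ht.1.le, ht.2.le.trans hx.2.le⟩
    rw [le_div_iff₀ (by positivity), zero_mul] at this
    exact nonneg_of_mul_nonneg_right this hq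
  · rintro ⟨h1, h2⟩ t ht
    have hanti := G.strictAntiOn_marginal ⟨hy.1, hy.2.le⟩
    have hcont : ContinuousOn (fun t => G.r₁ t y) (Icc 0 G.m₁) := fun t ht =>
      (hd t ht).continuousAt.continuousWithinAt
    rcases le_total t x with htx | htx
    · refine monotoneOn_of_deriv_nonneg (convex_Icc 0 x)
        (hcont.mono (Icc_subset_Icc_right hx.2.le))
        (fun s hs => (hd s ?_).differentiableAt.differentiableWithinAt) (fun s hs => ?_)
        ⟨ht.1, htx⟩ ⟨hx.1, le_rfl⟩ htx
      all_goals
        rw [interior_Icc] at hs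
        have hsI : s ∈ Icc 0 G.m₁ := ⟨hs.1.le, hs.2.le.trans hx.2.le⟩
      · exact hsI
      · rw [(hd s hsI).deriv]
        have h3 := hanti hsI hxI hs.2
        simp only [h2 (hs.1.trans hs.2)] at h3
        positivity
    · refine antitoneOn_of_deriv_nonpos (convex_Icc x G.m₁)
        (hcont.mono (Icc_subset_Icc_left hx.1))
        (fun s hs => (hd s ?_).differentiableAt.differentiableWithinAt) (fun s hs => ?_)
        ⟨le_rfl, hx.2.le⟩ ⟨htx, ht.2⟩ htx
      all_goals
        rw [interior_Icc] at hs
        have hsI : s ∈ Icc 0 G.m₁ := ⟨hx.1.trans hs.1.le, hs.2.le⟩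
      · exact hsI
      · rw [(hd s hsI).deriv]
        have h3 := hanti hxI hsI hs.1
        exact div_nonpos_of_nonpos_of_nonneg
          (mul_nonpos_of_nonneg_of_nonpos hq.le (h3.le.trans h1)) (sq_nonneg _)

/-- The first-order conditions of a pure Nash equilibrium. -/
structure IsCritical (G : MinersDilemma) (x y : ℝ) : Prop where
  left_mem : x ∈ Ico 0 G.m₁
  right_mem : y ∈ Ico 0 G.m₂
  left_nonpos : G.marginal x y ≤ 0
  right_nonpos : G.swap.marginal y x ≤ 0
  left_eq : 0 < x → G.marginal x y = 0
  right_eq : 0 < y → G.swap.marginal y x = 0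

theorem IsCritical.swap {G : MinersDilemma} {x y : ℝ} (h : G.IsCritical x y) :
    G.swap.IsCritical y x :=
  ⟨h.right_mem, h.left_mem, h.right_nonpos, h.left_nonpos, h.right_eq, h.left_eq⟩

theorem isPureNash_iff (G : MinersDilemma) (z : ℝ × ℝ) :
    G.IsPureNash z ↔ G.IsCritical z.1 z.2 := by
  unfold IsPureNash
  simp only [r₂_eq_swap]
  constructor
  · rintro ⟨hx, hy, h1, h2⟩
    have hx' : z.1 ∈ Ico 0 G.m₁ := ⟨hx.1, G.lt_of_isBestReply hy hx h1⟩
    have hy' : z.2 ∈ Ico 0 G.m₂ := ⟨hy.1, G.swap.lt_of_isBestReply hx hy h2⟩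
    obtain ⟨h3, h4⟩ := (G.isBestReply_iff hy' hx').1 h1
    obtain ⟨h5, h6⟩ := (G.swap.isBestReply_iff hx' hy').1 h2
    exact ⟨hx', hy', h3, h5, h4, h6⟩
  · intro h
    exact ⟨⟨h.left_mem.1, h.left_mem.2.le⟩, ⟨h.right_mem.1, h.right_mem.2.le⟩,
      (G.isBestReply_iff h.right_mem h.left_mem).2 ⟨h.left_nonpos, h.left_eq⟩,
      (G.swap.isBestReply_iff h.left_mem h.right_mem).2 ⟨h.right_nonpos, h.right_eq⟩⟩

/-! ### Uniqueness through the variational inequality. -/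

/-- `(x, y)` solves the variational inequality of the weighted marginals on the triangle
`x + y ≤ g`. -/
structure SolvesVI (G : MinersDilemma) (g x y : ℝ) : Prop where
  left_nonneg : 0 ≤ x
  right_nonneg : 0 ≤ y
  add_le : x + y ≤ g
  le : ∀ u v : ℝ, 0 ≤ u → 0 ≤ v → u + v ≤ g →
    G.m₁ * (u - x) * G.marginal x y + G.m₂ * (v - y) * G.swap.marginal y x ≤ 0

theorem SolvesVI.swap {G : MinersDilemma} {g x y : ℝ} (h : G.SolvesVI g x y) :
    G.swap.SolvesVI g y x :=
  ⟨h.right_nonneg, h.left_nonneg, by linarith [h.add_le], fun u v hu hv huv => by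
    have := h.le v u hv hu (by linarith)
    rw [add_comm]
    exact this⟩

/-- Testing each solution against the other and combining the two inequalities contradicts strict
monotonicity. -/
theorem SolvesVI.unique {G : MinersDilemma} {g x y x' y' : ℝ}
    (hg : g ^ 2 ≤ G.m₁ * G.m₂) (h : G.SolvesVI g x y) (h' : G.SolvesVI g x' y') :
    x = x' ∧ y = y' := by
  by_contra hne
  have h1 : x' - x ≠ 0 ∨ y' - y ≠ 0 := by
    rw [sub_ne_zero, sub_ne_zero]
    by_contra! hcon
    exact hne ⟨hcon.1.symm, hcon.2.symm⟩
  have h2 := G.strict_monotone_marginal hg h.left_nonneg h.right_nonneg h'.left_nonneg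
    h'.right_nonneg h.add_le h'.add_le h1
  have h3 := h.le x' y' h'.left_nonneg h'.right_nonneg h'.add_le
  have h4 := h'.le x y h.left_nonneg h.right_nonneg h.add_le
  linarith

theorem IsCritical.solvesVI {G : MinersDilemma} {g x y : ℝ} (h : G.IsCritical x y)
    (hs : x + y ≤ g) : G.SolvesVI g x y := by
  refine ⟨h.left_mem.1, h.right_mem.1, hs, fun u v hu hv _ => ?_⟩
  have key : ∀ c w z μ : ℝ, 0 < c → 0 ≤ w → 0 ≤ z → μ ≤ 0 → (0 < z → μ = 0) →
      c * (w - z) * μ ≤ 0 := by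
    intro c w z μ hc hw hz hμ h0
    rcases hz.eq_or_lt with rfl | hz
    · rw [sub_zero]
      exact mul_nonpos_of_nonneg_of_nonpos (by positivity) hμ
    · rw [h0 hz, mul_zero]
  exact add_nonpos (key _ u x _ G.m₁_pos hu h.left_mem.1 h.left_nonpos h.left_eq)
    (key _ v y _ G.m₂_pos hv h.right_mem.1 h.right_nonpos h.right_eq)

/-- A critical point outside of the triangle lies on a coordinate axis. -/
theorem IsCritical.eq_zero_or_eq_zero {G : MinersDilemma} {g x y : ℝ} (hg0 : 0 ≤ g)
    (hg : g ^ 2 = G.m₁ * G.m₂) (h : G.IsCritical x y) (hs : g < x + y) : x = 0 ∨ y = 0 := by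
  by_contra! hne
  have h1 := h.left_eq (h.left_mem.1.lt_of_ne' hne.1)
  have h2 := h.right_eq (h.right_mem.1.lt_of_ne' hne.2)
  have h3 := G.weighted_marginal_neg h.left_mem.1 h.right_mem.1
    (G.effective_pos h.left_mem.1 h.right_mem.1 (by linarith [h.left_mem.2, h.right_mem.2]))
    (by rw [← hg]; gcongr)
  rw [h1, h2] at h3
  simp at h3

/-- Cutting a critical point on an axis down to the triangle gives a solution of the
variational inequality. -/
theorem IsCritical.solvesVI_axis {G : MinersDilemma} {g y : ℝ} (hg0 : 0 < g)
    (hg : g ^ 2 = G.m₁ * G.m₂) (h : G.IsCritical 0 y) (hs : g < y) :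
    G.SolvesVI g 0 g ∧ 0 < G.swap.marginal g 0 := by
  have a := G.m₁_pos
  have b := G.m₂_pos
  have h2 : 0 < G.swap.marginal g 0 := by
    have := G.swap.strictAntiOn_marginal (y := 0) ⟨le_rfl, a.le⟩ (a := g) (b := y)
      ⟨hg0.le, hs.le.trans h.right_mem.2.le⟩ ⟨h.right_mem.1, h.right_mem.2.le⟩ hs
    simpa only [h.right_eq (hg0.trans hs)] using this
  -- On the line `x + y = g` the weighted sum is exactly `m₁ + m₂ - m ≤ 0`, so a positive marginal
  -- of pool 2 forces that of pool 1 down.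
  have h1 : G.marginal 0 g ≤ 0 := by
    have hw := G.weighted_marginal (G.den_pos le_rfl hg0.le).ne'
    rw [zero_add, hg, sub_self, mul_zero, mul_zero, zero_div] at hw
    have := mul_pos b h2
    exact nonpos_of_mul_nonpos_right (by linarith [G.add_le]) a
  refine ⟨⟨le_rfl, hg0.le, by simp, fun u v hu hv huv => ?_⟩, h2⟩
  rw [sub_zero]
  exact add_nonpos (mul_nonpos_of_nonneg_of_nonpos (by positivity) h1)
    (mul_nonpos_of_nonpos_of_nonneg
      (mul_nonpos_of_nonneg_of_nonpos b.le (by linarith)) h2.le)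

/-- The cut point `(0, g)` is the only solution of the variational inequality and is not critical,
which excludes critical points in the triangle. One beyond it on the other axis would make `(g, 0)`
a second solution; on the same axis strict monotonicity of the marginal decides. -/
theorem IsCritical.unique_of_axis {G : MinersDilemma} {g y x' y' : ℝ} (hg0 : 0 < g)
    (hg : g ^ 2 = G.m₁ * G.m₂) (h : G.IsCritical 0 y) (hs : g < y) (h' : G.IsCritical x' y') :
    0 = x' ∧ y = y' := by
  obtain ⟨hV, hpos⟩ := h.solvesVI_axis hg0 hg hs
  rcases le_or_gt (x' + y') g with hs' | hs'
  · obtain ⟨rfl, rfl⟩ := hV.unique hg.le (h'.solvesVI hs')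
    exact absurd h'.right_nonpos hpos.not_ge
  · rcases h'.eq_zero_or_eq_zero hg0.le hg hs' with rfl | rfl
    · rw [zero_add] at hs'
      refine ⟨rfl, (G.swap.strictAntiOn_marginal (y := 0) ⟨le_rfl, G.m₁_pos.le⟩).injOn
        ⟨h.right_mem.1, h.right_mem.2.le⟩ ⟨h'.right_mem.1, h'.right_mem.2.le⟩ ?_⟩
      simp only [h.right_eq (hg0.trans hs), h'.right_eq (hg0.trans hs')]
    · rw [add_zero] at hs'
      have hg' : g ^ 2 = G.swap.m₁ * G.swap.m₂ := by
        rw [hg]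
        exact mul_comm _ _
      have hV' := (h'.swap.solvesVI_axis hg0 hg' hs').1
      exact absurd (hV.swap.unique hg'.le hV').1 hg0.ne'

theorem IsCritical.unique {G : MinersDilemma} {x y x' y' : ℝ} (h : G.IsCritical x y)
    (h' : G.IsCritical x' y') : x = x' ∧ y = y' := by
  have hab := mul_pos G.m₁_pos G.m₂_pos
  obtain ⟨g, hg0, hg⟩ : ∃ g : ℝ, 0 < g ∧ g ^ 2 = G.m₁ * G.m₂ :=
    ⟨√(G.m₁ * G.m₂), Real.sqrt_pos.2 hab, Real.sq_sqrt hab.le⟩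
  have hg' : g ^ 2 = G.swap.m₁ * G.swap.m₂ := by
    rw [hg]
    exact mul_comm _ _
  have key : ∀ {x y x' y' : ℝ}, G.IsCritical x y → G.IsCritical x' y' → g < x + y →
      x = x' ∧ y = y' := by
    intro x y x' y' h h' hs
    rcases h.eq_zero_or_eq_zero hg0.le hg hs with rfl | rfl
    · exact h.unique_of_axis hg0 hg (by simpa using hs) h'
    · exact (h.swap.unique_of_axis hg0 hg' (by simpa using hs) h'.swap).symm
  rcases lt_or_ge g (x + y) with hs | hs
  · exact key h h' hs
  rcases lt_or_ge g (x' + y') with hs' | hs'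
  · obtain ⟨h1, h2⟩ := key h' h hs'
    exact ⟨h1.symm, h2.symm⟩
  · exact (h.solvesVI hs).unique hg.le (h'.solvesVI hs')

/-! ### Existence through a continuous reply function. -/

/-- The zeros of a family of strictly decreasing functions, cut off at `0`, depend continuously
on the parameter. -/
theorem exists_continuousOn_reply {f : ℝ → ℝ → ℝ} {a : ℝ} {s : Set ℝ} (ha : 0 ≤ a)
    (hx : ∀ y ∈ s, ContinuousOn (fun x => f x y) (Icc 0 a))
    (hy : ∀ x ∈ Icc 0 a, ContinuousOn (f x) s)
    (hanti : ∀ y ∈ s, StrictAntiOn (fun x => f x y) (Icc 0 a))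
    (hr : ∀ y ∈ s, f a y ≤ 0) :
    ∃ β : ℝ → ℝ, ContinuousOn β s ∧
      ∀ y ∈ s, β y ∈ Icc 0 a ∧ f (β y) y ≤ 0 ∧ (0 < β y → f (β y) y = 0) := by
  have hex : ∀ y, ∃ x, y ∈ s → x ∈ Icc 0 a ∧ f x y ≤ 0 ∧ (0 < x → f x y = 0) := by
    intro y
    by_cases hys : y ∈ s
    · rcases le_or_gt (f 0 y) 0 with h0 | h0
      · exact ⟨0, fun _ => ⟨⟨le_rfl, ha⟩, h0, fun h => absurd h (lt_irrefl _)⟩⟩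
      · obtain ⟨x, hxI, hx0⟩ := intermediate_value_Icc' ha (hx y hys) ⟨hr y hys, h0.le⟩
        exact ⟨x, fun _ => ⟨hxI, le_of_eq hx0, fun _ => hx0⟩⟩
    · exact ⟨0, fun h => absurd h hys⟩
  choose β hβ using hex
  refine ⟨β, fun y hys => ?_, hβ⟩
  obtain ⟨hI, hle, heq⟩ := hβ y hys
  refine tendsto_order.2 ⟨fun l hl => ?_, fun u hu => ?_⟩
  · rcases lt_or_ge l 0 with hl0 | hl0
    · filter_upwards [self_mem_nhdsWithin] with z hz
      exact hl0.trans_le (hβ z hz).1.1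
    · have hlI : l ∈ Icc 0 a := ⟨hl0, hl.le.trans hI.2⟩
      -- A strict sign of `f l` at `y` persists for nearby parameters and keeps their zeros on the
      -- same side of `l`; the upper bound is symmetric.
      have h1 : 0 < f l y := by
        rw [← heq (hl0.trans_lt hl)]
        exact hanti y hys hlI hI hl
      filter_upwards [self_mem_nhdsWithin, (hy l hlI y hys).eventually (lt_mem_nhds h1)]
        with z hz hlz
      by_contra! hcon
      have := (hanti z hz).antitoneOn (hβ z hz).1 hlI hcon
      exact absurd ((hlz.trans_le this).trans_le (hβ z hz).2.1) (lt_irrefl _)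
  · rcases lt_or_ge a u with hau | hua
    · filter_upwards [self_mem_nhdsWithin] with z hz
      exact (hβ z hz).1.2.trans_lt hau
    · have huI : u ∈ Icc 0 a := ⟨hI.1.trans hu.le, hua⟩
      have h1 : f u y < 0 := (hanti y hys hI huI hu).trans_le hle
      filter_upwards [self_mem_nhdsWithin, (hy u huI y hys).eventually (gt_mem_nhds h1)]
        with z hz huz
      by_contra! hcon
      have h2 := (hanti z hz).antitoneOn huI (hβ z hz).1 hcon
      have h3 := (hβ z hz).2.2 ((hI.1.trans_lt hu).trans_le hcon)
      simp only [h3] at h2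
      exact absurd (h2.trans_lt huz) (lt_irrefl _)

theorem exists_isCritical (G : MinersDilemma) : ∃ x y, G.IsCritical x y := by
  have a := G.m₁_pos
  have b := G.m₂_pos
  have hc := G.continuousOn_marginal
  have hc' := G.swap.continuousOn_marginal
  obtain ⟨β, hβc, hβ⟩ := exists_continuousOn_reply (f := G.marginal) (s := Icc 0 G.m₂) a.le
    (fun y hy => hc.comp (f := fun x => (x, y)) (by fun_prop) fun x hx => ⟨hx.1, hy.1⟩)
    (fun x hx => hc.comp (f := fun y => (x, y)) (by fun_prop) fun y hy => ⟨hx.1, hy.1⟩)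
    (fun y hy => G.strictAntiOn_marginal hy) (fun y hy => G.marginal_right_nonpos hy)
  have hlt : ∀ y ∈ Ico 0 G.m₂, β y < G.m₁ := by
    intro y hy
    have hyI : y ∈ Icc 0 G.m₂ := ⟨hy.1, hy.2.le⟩
    obtain ⟨h1, -, h3⟩ := hβ y hyI
    refine h1.2.lt_of_ne fun h => ?_
    have h4 := G.marginal_right_neg hyI (G.effective_pos a.le hy.1 (by linarith [hy.2]))
    have h5 := h3 (h ▸ a)
    rw [h] at h5
    linarith
  have hcont : ContinuousOn (fun y => G.swap.marginal y (β y)) (Icc 0 G.m₂) :=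
    hc'.comp (f := fun y => (y, β y)) (continuousOn_id.prodMk hβc)
      fun y hy => ⟨hy.1, (hβ y hy).1.1⟩
  have hbI : G.m₂ ∈ Icc 0 G.m₂ := ⟨b.le, le_rfl⟩
  -- The endpoint `m₂` itself may be degenerate, with vanishing marginals, so the negative value is
  -- sought at some `y < m₂` close to it.
  have hneg : ∃ y ∈ Ico 0 G.m₂, G.swap.marginal y (β y) < 0 := by
    have hcl : (𝓝[Ico 0 G.m₂] G.m₂).NeBot := by
      rw [← mem_closure_iff_nhdsWithin_neBot, closure_Ico b.ne]
      exact hbI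
    have hsub : 𝓝[Ico 0 G.m₂] G.m₂ ≤ 𝓝[Icc 0 G.m₂] G.m₂ := nhdsWithin_mono _ Ico_subset_Icc_self
    have hmem : ∀ᶠ y in 𝓝[Ico 0 G.m₂] G.m₂, y ∈ Ico 0 G.m₂ := self_mem_nhdsWithin
    -- If the reply tends to `m₁`, the points near the corner satisfy `(x + y) ^ 2 > m₁ m₂` and the
    -- marginal of pool 1 is zero there, so the weighted sum gives the sign. Otherwise the marginal
    -- of pool 2 is already negative at `m₂`.
    rcases (hβ _ hbI).1.2.eq_or_lt with hb | hb
    · have h1 : ∀ᶠ y in 𝓝[Ico 0 G.m₂] G.m₂, 0 < β y :=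
        hsub ((hβc _ hbI).eventually (lt_mem_nhds (by rw [hb]; exact a)))
      have h2 : ∀ᶠ y in 𝓝[Ico 0 G.m₂] G.m₂, G.m₁ * G.m₂ < (β y + y) ^ 2 := by
        have : ContinuousOn (fun y => (β y + y) ^ 2) (Icc 0 G.m₂) := by fun_prop
        refine hsub ((this _ hbI).eventually (lt_mem_nhds ?_))
        simp only [hb]
        nlinarith [mul_pos a b]
      obtain ⟨y, hy, hy1, hy2⟩ := (hmem.and (h1.and h2)).exists
      have hyI := Ico_subset_Icc_self hy
      refine ⟨y, hy, ?_⟩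
      have hw := G.weighted_marginal_neg hy1.le hy.1
        (G.effective_pos hy1.le hy.1 (by linarith [hy.2, hlt y hy])) hy2
      rw [(hβ y hyI).2.2 hy1, mul_zero, zero_add] at hw
      exact neg_of_mul_neg_right hw b.le
    · have h1 : G.swap.marginal G.m₂ (β G.m₂) < 0 :=
        G.swap.marginal_right_neg (hβ _ hbI).1 (by
          change 0 < G.swap.effective G.m₂ _
          rw [effective_swap]
          exact G.effective_pos (hβ _ hbI).1.1 b.le (by linarith))
      have h2 : ∀ᶠ y in 𝓝[Ico 0 G.m₂] G.m₂, G.swap.marginal y (β y) < 0 :=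
        hsub ((hcont _ hbI).eventually (gt_mem_nhds h1))
      exact (hmem.and h2).exists
  obtain ⟨c, hcI, hcneg⟩ := hneg
  have finish : ∀ y ∈ Ico 0 G.m₂, G.swap.marginal y (β y) ≤ 0 →
      (0 < y → G.swap.marginal y (β y) = 0) → G.IsCritical (β y) y := fun y hy h1 h2 =>
    have h := hβ y (Ico_subset_Icc_self hy)
    ⟨⟨h.1.1, hlt y hy⟩, hy, h.2.1, h1, h.2.2, h2⟩
  rcases le_or_gt (G.swap.marginal 0 (β 0)) 0 with h0 | h0
  · exact ⟨_, 0, finish 0 ⟨le_rfl, b⟩ h0 fun h => absurd h (lt_irrefl _)⟩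
  · obtain ⟨y, hyI, hy0⟩ := intermediate_value_Icc' hcI.1
      (hcont.mono (Icc_subset_Icc_right hcI.2.le)) ⟨hcneg.le, h0.le⟩
    exact ⟨_, y, finish y ⟨hyI.1, hyI.2.trans_lt hcI.2⟩ (le_of_eq hy0) fun _ => hy0⟩

end

end MinersDilemma

theorem theorem2 (G : MinersDilemma) : ∃! x : ℝ × ℝ, G.IsPureNash x := by
  obtain ⟨x, y, h⟩ := G.exists_isCritical
  refine ⟨(x, y), (G.isPureNash_iff _).2 h, fun z hz => ?_⟩
  obtain ⟨h1, h2⟩ := ((G.isPureNash_iff z).1 hz).unique h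
  exact Prod.ext h1 h2
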